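/- Let $G$ be a finite simple graph with a VPG representation $(\mathcal{G},\mathcal{P})$: that is, $\mathcal{G}$ is a rectangular grid and $\mathcal{P}=(P_v)_{v\in V(G)}$ is a family of (simple) paths in $\mathcal{G}$, each using at least one grid-edge, such that two distinct vertices $u,v$ of $G$ are adjacent if and only if $P_u$ and $P_v$ share a grid-point. Let $t,\ell\ge 0$ be integers such that each grid-edge of $\mathcal{G}$ belongs to at most $t$ of the paths $P_v$, $v\in V(G)$, and $\mathcal{G}$ has at most $\ell$ columns (vertical lines). Then the tree-width of $G$ satisfies $$\mathrm{tw}(G)\le 9t(\ell+1)-1.$$ Here $\mathrm{tw}(G)$ is the minimum, over all tree decompositions of $G$, of the maximum size of a bag minus one (so the graph with no vertices has tree-width $-1$). -/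

import Mathlib

/-- The rectangular grid with `c` columns and `r` rows. The grid-point `(x, y)` lies on column `x`
and row `y`; the grid-edges join consecutive grid-points of a common row or column. -/
def rectGrid (c r : ℕ) : SimpleGraph (Fin c × Fin r) :=
  (SimpleGraph.pathGraph c).boxProd (SimpleGraph.pathGraph r)

/-- A VPG representation of `G`: a rectangular grid and, for each vertex `v` of `G`, a path in it
using at least one grid-edge, such that distinct vertices are adjacent in `G` if and only if their
paths share a grid-point. -/
structure VPGRepresentation {V : Type*} (G : SimpleGraph V) where
  columns : ℕ
  rows : ℕ
  source : V → Fin columns × Fin rows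
  target : V → Fin columns × Fin rows
  path : ∀ v : V, (rectGrid columns rows).Walk (source v) (target v)
  isPath : ∀ v : V, (path v).IsPath
  length_pos : ∀ v : V, 0 < (path v).length
  adj_iff : ∀ u v : V, u ≠ v →
    (G.Adj u v ↔ ∃ p : Fin columns × Fin rows, p ∈ (path u).support ∧ p ∈ (path v).support)

/-- A tree decomposition of a graph, over a finite tree. -/
structure TreeDecomposition {V : Type*} (G : SimpleGraph V) where
  Node : Type
  fintypeNode : Fintype Node
  tree : SimpleGraph Node
  isTree : tree.IsTree
  bag : Node → Finset V
  exists_mem_bag : ∀ v : V, ∃ i : Node, v ∈ bag i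
  exists_adj_bag : ∀ u v : V, G.Adj u v → ∃ i : Node, u ∈ bag i ∧ v ∈ bag i
  connected_nodes : ∀ v : V, (tree.induce {i : Node | v ∈ bag i}).Connected

/-- The width of a tree decomposition: the largest size of a bag, minus one. -/
def TreeDecomposition.width {V : Type*} {G : SimpleGraph V} (D : TreeDecomposition G) : ℤ :=
  ((D.fintypeNode.elems.sup fun i => (D.bag i).card : ℕ) : ℤ) - 1

/-- The tree-width of a finite graph: the minimum width of a tree decomposition. It is an integer,
so that the graph without vertices has tree-width `-1`. The minimum exists for a finite graph: the
widths are bounded below by `-1`, and a single bag that holds all vertices is a tree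
decomposition. -/
noncomputable def treewidth {V : Type*} (G : SimpleGraph V) : ℤ :=
  sInf (Set.range fun D : TreeDecomposition G => D.width)

namespace SimpleGraph

/-! Sweep the grid row by row, the bag of a row being the vertices whose paths meet it. Each step of
a path changes the row by at most one, so the rows it meets are consecutive, and paths sharing a
point share a row: this is a path decomposition (`rowDecomposition`). A path meeting a row uses an
edge at one of its at most `ℓ` points, each of degree at most 4, so bags have size at most `4tℓ`
(`card_rowBag_le`). -/

theorem pathGraph_isAcyclic (n : ℕ) : (pathGraph n).IsAcyclic := by
  have cut : ∀ u v : Fin n, u.val + 1 = v.val → (pathGraph n).IsBridge s(u, v) := by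
    intro u v huv
    rw [isBridge_iff]
    rintro ⟨w⟩
    -- The deleted edge is the only one leaving the initial segment up to `u`.
    have stays_below : ∀ a b : Fin n, ((pathGraph n).deleteEdges {s(u, v)}).Walk a b →
        a ≤ u → b ≤ u := by
      intro a b w
      induction w with
      | nil => exact id
      | @cons a b _ hab _ ih =>
        intro ha
        refine ih ?_
        rw [deleteEdges_adj, pathGraph_adj] at hab
        obtain ⟨hab, hne⟩ := hab
        by_contra hb
        refine hne ?_
        rw [Fin.le_def] at ha hb
        have h1 : a = u := Fin.ext (by omega)
        have h2 : b = v := Fin.ext (by omega)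
        simp [h1, h2]
    have := stays_below u v w le_rfl
    rw [Fin.le_def] at this
    omega
  rw [isAcyclic_iff_forall_adj_isBridge]
  intro u v huv
  rw [pathGraph_adj] at huv
  rcases huv with h | h
  · exact cut u v h
  · rw [Sym2.eq_swap]
    exact cut v u h

theorem pathGraph_isTree (n : ℕ) : (pathGraph (n + 1)).IsTree :=
  ⟨pathGraph_connected n, pathGraph_isAcyclic (n + 1)⟩

open Classical in
theorem degree_pathGraph_le_two {n : ℕ} (i : Fin n) : (pathGraph n).degree i ≤ 2 := by
  rw [← card_neighborFinset_eq_degree]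
  calc ((pathGraph n).neighborFinset i).card
      = (((pathGraph n).neighborFinset i).image Fin.val).card :=
        (Finset.card_image_of_injective _ Fin.val_injective).symm
    -- For `i = 0` truncated subtraction only adds the spurious element 0, harmless for an upper
    -- bound.
    _ ≤ ({i.val - 1, i.val + 1} : Finset ℕ).card := by
        refine Finset.card_le_card fun k hk => ?_
        obtain ⟨j, hj, rfl⟩ := Finset.mem_image.mp hk
        rw [mem_neighborFinset, pathGraph_adj] at hj
        simp only [Finset.mem_insert, Finset.mem_singleton]
        omega
    _ ≤ 2 := Finset.card_le_two

end SimpleGraph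

open Classical in
theorem degree_rectGrid_le_four {c r : ℕ} (p : Fin c × Fin r) : (rectGrid c r).degree p ≤ 4 := by
  have h := SimpleGraph.degree_boxProd (G := SimpleGraph.pathGraph c)
    (H := SimpleGraph.pathGraph r) p
  have h1 := SimpleGraph.degree_pathGraph_le_two p.1
  have h2 := SimpleGraph.degree_pathGraph_le_two p.2
  calc (rectGrid c r).degree p = _ := by
        unfold rectGrid
        convert h
    _ ≤ 4 := by omega

/-- The rows met by a walk in the grid induce a connected subgraph of the path of all rows. -/
theorem induce_rows_reachable {c r : ℕ} {a b : Fin c × Fin r} (w : (rectGrid c r).Walk a b)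
    (S : Set (Fin r)) (hS : ∀ p ∈ w.support, p.2 ∈ S) (p : Fin c × Fin r) (hp : p ∈ w.support) :
    ((SimpleGraph.pathGraph r).induce S).Reachable ⟨a.2, hS a w.start_mem_support⟩
      ⟨p.2, hS p hp⟩ := by
  induction w with
  | nil =>
    obtain rfl := List.mem_singleton.mp hp
    exact .rfl
  | @cons a b d hab w ih =>
    rw [SimpleGraph.Walk.support_cons, List.mem_cons] at hp
    rcases hp with rfl | hp
    · exact .rfl
    have hS' : ∀ q ∈ w.support, q.2 ∈ S := fun q hq => hS q (by simp [hq])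
    refine .trans ?_ (ih hS' hp)
    rcases SimpleGraph.boxProd_adj.mp hab with ⟨-, h⟩ | ⟨h, -⟩
    · simp only [h]
      exact .rfl
    · exact SimpleGraph.Adj.reachable (G := (SimpleGraph.pathGraph r).induce S) h

theorem TreeDecomposition.neg_one_le_width {V : Type*} {G : SimpleGraph V}
    (D : TreeDecomposition G) : -1 ≤ D.width := by
  unfold TreeDecomposition.width
  omega

theorem treewidth_le_width {V : Type*} {G : SimpleGraph V} (D : TreeDecomposition G) :
    treewidth G ≤ D.width :=
  csInf_le ⟨-1, by rintro _ ⟨D, rfl⟩; exact D.neg_one_le_width⟩ ⟨D, rfl⟩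

theorem TreeDecomposition.width_le {V : Type*} {G : SimpleGraph V} (D : TreeDecomposition G)
    {k : ℕ} (h : ∀ i, (D.bag i).card ≤ k) : D.width ≤ (k : ℤ) - 1 := by
  have : (D.fintypeNode.elems.sup fun i => (D.bag i).card) ≤ k := Finset.sup_le fun i _ => h i
  unfold TreeDecomposition.width
  omega

/-- The tree decomposition of a graph without vertices with a single, empty bag. -/
def TreeDecomposition.ofIsEmpty {V : Type*} [IsEmpty V] (G : SimpleGraph V) :
    TreeDecomposition G where
  Node := Unit
  fintypeNode := inferInstance
  tree := ⊥
  isTree := SimpleGraph.IsTree.of_subsingleton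
  bag _ := ∅
  exists_mem_bag v := isEmptyElim v
  exists_adj_bag v := isEmptyElim v
  connected_nodes v := isEmptyElim v

namespace VPGRepresentation

variable {V : Type*} [Finite V] {G : SimpleGraph V} (R : VPGRepresentation G)

/-- The vertices whose paths meet row `y`. -/
noncomputable def rowBag (y : Fin R.rows) : Finset V :=
  (Set.toFinite {v : V | ∃ p ∈ (R.path v).support, p.2 = y}).toFinset

theorem mem_rowBag {y : Fin R.rows} {v : V} :
    v ∈ R.rowBag y ↔ ∃ p ∈ (R.path v).support, p.2 = y := by
  simp [rowBag]

/-- The path decomposition along the rows of the grid. -/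
noncomputable def rowDecomposition (h : 0 < R.rows) : TreeDecomposition G where
  Node := Fin R.rows
  fintypeNode := inferInstance
  tree := SimpleGraph.pathGraph R.rows
  isTree := by
    obtain ⟨n, hn⟩ := Nat.exists_eq_add_one_of_ne_zero h.ne'
    rw [hn]
    exact SimpleGraph.pathGraph_isTree n
  bag := R.rowBag
  exists_mem_bag v :=
    ⟨(R.source v).2, R.mem_rowBag.mpr ⟨_, (R.path v).start_mem_support, rfl⟩⟩
  exists_adj_bag u v huv := by
    obtain ⟨p, hu, hv⟩ := (R.adj_iff u v huv.ne).mp huv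
    exact ⟨p.2, R.mem_rowBag.mpr ⟨p, hu, rfl⟩, R.mem_rowBag.mpr ⟨p, hv, rfl⟩⟩
  connected_nodes v := by
    rw [SimpleGraph.connected_iff_exists_forall_reachable]
    have hS : ∀ p ∈ (R.path v).support, p.2 ∈ {i | v ∈ R.rowBag i} :=
      fun p hp => R.mem_rowBag.mpr ⟨p, hp, rfl⟩
    refine ⟨⟨(R.source v).2, hS _ (R.path v).start_mem_support⟩, ?_⟩
    rintro ⟨y, hy⟩
    obtain ⟨p, hp, rfl⟩ := R.mem_rowBag.mp hy
    exact induce_rows_reachable (R.path v) _ hS p hp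

open Classical in
theorem card_rowBag_le {t : ℕ}
    (ht : ∀ e ∈ (rectGrid R.columns R.rows).edgeSet, {v : V | e ∈ (R.path v).edges}.ncard ≤ t)
    (y : Fin R.rows) : (R.rowBag y).card ≤ R.columns * 4 * t := by
  let E : Finset (Sym2 (Fin R.columns × Fin R.rows)) :=
    Finset.univ.biUnion fun x => (rectGrid R.columns R.rows).incidenceFinset (x, y)
  have hE : E.card ≤ R.columns * 4 := by
    simpa using Finset.card_biUnion_le_card_mul Finset.univ
      (fun x => (rectGrid R.columns R.rows).incidenceFinset (x, y)) 4 fun x _ => by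
        rw [SimpleGraph.card_incidenceFinset_eq_degree]
        exact degree_rectGrid_le_four (x, y)
  have hsub : R.rowBag y ⊆
      E.biUnion fun e => (Set.toFinite {v : V | e ∈ (R.path v).edges}).toFinset := by
    intro v hv
    obtain ⟨⟨x, _⟩, hp, rfl⟩ := R.mem_rowBag.mp hv
    -- A one-point path would meet the row without being charged to any edge.
    have hnil : ¬ (R.path v).Nil := by
      rw [← SimpleGraph.Walk.length_eq_zero_iff]
      exact (R.length_pos v).ne'
    obtain ⟨e, he, hpe⟩ :=
      (SimpleGraph.Walk.mem_support_iff_exists_mem_edges_of_not_nil hnil).mp hp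
    refine Finset.mem_biUnion.mpr ⟨e, Finset.mem_biUnion.mpr ⟨x, Finset.mem_univ _, ?_⟩,
      by simpa using he⟩
    rw [SimpleGraph.mem_incidenceFinset]
    exact ⟨(R.path v).edges_subset_edgeSet he, hpe⟩
  calc (R.rowBag y).card ≤ _ := Finset.card_le_card hsub
    _ ≤ E.card * t := by
        refine Finset.card_biUnion_le_card_mul _ _ _ fun e he => ?_
        rw [← Set.ncard_eq_toFinset_card]
        obtain ⟨x, -, hx⟩ := Finset.mem_biUnion.mp he
        rw [SimpleGraph.mem_incidenceFinset] at hx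
        exact ht e hx.1
    _ ≤ R.columns * 4 * t := Nat.mul_le_mul_right t hE

end VPGRepresentation

theorem corollary4p4 {V : Type*} [Finite V] (G : SimpleGraph V) (R : VPGRepresentation G)
    (t ℓ : ℕ)
    (ht : ∀ e ∈ (rectGrid R.columns R.rows).edgeSet,
      {v : V | e ∈ (R.path v).edges}.ncard ≤ t)
    (hℓ : R.columns ≤ ℓ) :
    treewidth G ≤ 9 * (t : ℤ) * ((ℓ : ℤ) + 1) - 1 := by
  suffices ∃ D : TreeDecomposition G, ∀ i, (D.bag i).card ≤ 9 * t * (ℓ + 1) by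
    obtain ⟨D, hD⟩ := this
    exact_mod_cast (treewidth_le_width D).trans (D.width_le hD)
  -- Without vertices the grid may have no rows, and the empty path graph is not a tree.
  rcases isEmpty_or_nonempty V with hV | ⟨⟨v⟩⟩
  · exact ⟨.ofIsEmpty G, fun _ => Nat.zero_le _⟩
  · refine ⟨R.rowDecomposition (Fin.pos (R.source v).2), fun y => ?_⟩
    calc (R.rowBag y).card ≤ R.columns * 4 * t := R.card_rowBag_le ht y
      -- The count has slack: 4 is relaxed to 9 and `ℓ` to `ℓ + 1`.
      _ ≤ (ℓ + 1) * 9 * t := by gcongr <;> omega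
      _ = 9 * t * (ℓ + 1) := by ring
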